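/- Let $\mathcal X,\mathcal Y,\mathcal Z$ be finite alphabets, let $p(y,z|x)$ be an arbitrary wiretap channel (used memorylessly; $X$ is the input, $Y$ the output of the legitimate receiver, $Z$ the output of the eavesdropper), and let $p(x)$ be any input distribution. Put $p(z)=\sum_x p(x)p(z|x)$ and $q(z^n)=\prod_{i=1}^n p(z_i)$. All logarithms are in base two, $I(X;Y)$ is the mutual information of $(X,Y)\sim p(x)p(y|x)$, and $D_\infty(P\|Q)=\log\max_a \frac{P(a)}{Q(a)}$ (with $0/0=0$, $c/0=\infty$ for $c>0$); below, $0\cdot\infty=0$. A code of block length $n$ with $M_n$ messages consists of a (possibly randomized) encoder $p(x^n|m)$, $m\in\{1,\dots,M_n\}$, and a decoder $\mathcal Y^n\to\{1,\dots,M_n\}$. The message $M$ is uniformly distributed; we write $p^U(m)=1/M_n$, $p(m,z^n)=p^U(m)\sum_{x^n}p(x^n|m)\prod_{i=1}^n p(z_i|x_i)$ for the joint law of the message and the eavesdropper's observation, and $\hat M$ for the decoder's output. Then for every real number $$R<I(X;Y)-\sum_x p(x)\,D_\infty\big(p(z|x)\,\|\,p(z)\big)$$ there is a sequence of codes, of block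 lengths $n=0,1,2,\dots$ and with $M_n=\lceil 2^{nR}\rceil$ messages, such that $$\lim_{n\to\infty}\mathbb P[\hat M\neq M]=0\qquad\text{and}\qquad \lim_{n\to\infty}D_\infty\big(p(m,z^n)\,\|\,p^U(m)\,q(z^n)\big)=0 .$$ -/

import Mathlib

open Filter Topology
open scoped ENNReal BigOperators

noncomputable section

namespace Wiretap

/-- Product of finitely many probability mass functions on a finite alphabet: the law of a vector
with independent coordinates, `a ↦ ∏ i, p i (a i)`. -/
def piPMF {α : Type*} [Fintype α] {n : ℕ} (p : Fin n → PMF α) : PMF (Fin n → α) :=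
  PMF.ofFintype (fun a => ∏ i, p i (a i)) (by
    classical
    have h := Finset.prod_univ_sum (fun _ : Fin n => (Finset.univ : Finset α))
      (fun i a => p i a)
    rw [Fintype.piFinset_univ] at h
    rw [← h]
    refine Finset.prod_eq_one fun i _ => ?_
    rw [← tsum_fintype (L := .unconditional α)]
    exact (p i).tsum_coe)

/-- Law of a pair of independent random variables. -/
def indepPair {α β : Type*} (p : PMF α) (q : PMF β) : PMF (α × β) :=
  p.bind fun a => q.map fun b => (a, b)

/-- Rényi divergence of order infinity, in bits: `log₂ max_a (p a / q a)`, with `0 / 0 = 0` and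
`c / 0 = ∞` for `c > 0`, so that it equals `⊤` exactly when some atom of `p` has `q`-mass zero. -/
def dInf {α : Type*} (p q : PMF α) : EReal :=
  ENNReal.log (⨆ a, p a / q a) / ((Real.log 2 : ℝ) : EReal)

/-- Mutual information, in bits, of a pair of finite-valued random variables with joint law `r`. -/
def mutualInfo {α β : Type*} [Fintype α] [Fintype β] (r : PMF (α × β)) : ℝ :=
  ∑ a, ∑ b, (r (a, b)).toReal *
    Real.logb 2 ((r (a, b)).toReal /
      ((r.map Prod.fst a).toReal * (r.map Prod.snd b).toReal))

section Channel

variable {X Y Z : Type*}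

/-- The conditional law `p(z|x)` of a wiretap channel `W = p(y,z|x)`. -/
def eveChannel (W : X → PMF (Y × Z)) (x : X) : PMF Z := (W x).map Prod.snd

/-- The output law `p(z) = ∑ x, p(x) p(z|x)` at the eavesdropper. -/
def eveLaw (p : PMF X) (W : X → PMF (Y × Z)) : PMF Z := p.bind (eveChannel W)

/-- The joint law `p(x,y) = p(x) p(y|x)` of the input and the legitimate output. -/
def inputOutputLaw (p : PMF X) (W : X → PMF (Y × Z)) : PMF (X × Y) :=
  p.bind fun x => (W x).map fun yz => (x, yz.1)

/-- A wiretap code of block length `n` with message set `Fin M`: a (randomized) encoder `p(xⁿ|m)`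
and a decoder of the legitimate receiver. -/
structure Code (X Y : Type*) (n M : ℕ) where
  enc : Fin M → PMF (Fin n → X)
  dec : (Fin n → Y) → Fin M

namespace Code

variable [Fintype Y] [Fintype Z] {n M : ℕ} [NeZero M]

/-- Joint law of `(M, (Yⁿ, Zⁿ))` when a uniform message `M` is encoded by `C` and `Xⁿ` is sent over
`n` independent uses of the channel `W`. -/
def law (C : Code X Y n M) (W : X → PMF (Y × Z)) : PMF (Fin M × (Fin n → Y × Z)) :=
  (PMF.uniformOfFintype (Fin M)).bind fun m =>
    (C.enc m).bind fun x => (piPMF fun i => W (x i)).map fun yz => (m, yz)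

/-- The probability that the decoded message differs from the (uniform) message sent. -/
def errorProb (C : Code X Y n M) (W : X → PMF (Y × Z)) : ℝ≥0∞ :=
  (C.law W).toOuterMeasure {ω | C.dec (fun i => (ω.2 i).1) ≠ ω.1}

/-- The joint law `p(m, zⁿ)` of the message and the eavesdropper's observation. -/
def leakLaw (C : Code X Y n M) (W : X → PMF (Y × Z)) : PMF (Fin M × (Fin n → Z)) :=
  (C.law W).map fun ω => (ω.1, fun i => (ω.2 i).2)

end Code

end Channel

/-- Number of messages of a code of rate `R` and block length `n`. -/
def numMessages (R : ℝ) (n : ℕ) : ℕ := ⌈(2 : ℝ) ^ ((n : ℝ) * R)⌉₊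

instance (R : ℝ) (n : ℕ) : NeZero (numMessages R n) :=
  ⟨(Nat.ceil_pos.mpr (Real.rpow_pos_of_pos two_pos _)).ne'⟩

end Wiretap

end

/-! For `R < 0` there is one message, and sending memoryless input of law `p` leaks nothing. For `R
≥ 0`, work in nats, let D be the mean letter divergence and J the mutual information, and draw a
random codebook of M·L words; a message is sent as a uniformly chosen word among its L. Secrecy in
order infinity needs, for every message and every eavesdropper output z, that the average of U(x,z)
over these L words is at most (1+ε)²q(z). The words are drawn from the memoryless law conditioned on
the divergences of the letters adding up to at most n(D+δ). Conditioning inflates the law by at most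
1+ε and makes U(x,z)/q(z) at most β = exp(n(D+δ)) everywhere. With L about exp(n(D+2δ)), the
Chernoff bound `sum_codebook_upper_tail_le` makes each violation doubly exponentially unlikely,
which beats the M·|Z|^n events of the union bound. Reliability holds because all M·L words can be
decoded by a likelihood threshold: R+D+2δ is below J. `exists_codebook` finds one codebook with both
properties, and a diagonal choice over ε gives the sequence. -/

namespace Wiretap

/-! ### Product sums and an exponential tail bound -/

/-- Expectations of products of functions of distinct coordinates factorize. -/
theorem sum_pi_prod {ι A R : Type*} [Fintype ι] [DecidableEq ι] [Fintype A]
    [CommSemiring R] (F : ι → A → R) :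
    ∑ c : ι → A, ∏ i, F i (c i) = ∏ i, ∑ a, F i a := by
  rw [Finset.prod_univ_sum, Fintype.piFinset_univ]

/-- Exponential Markov inequality for the lower tail of a sum of independent variables. -/
theorem exists_lower_tail_le {A : Type*} [Fintype A] (w f : A → ℝ) (c : ℝ)
    (hw : ∀ a, 0 ≤ w a) (hw1 : ∑ a, w a = 1) (hc : c < ∑ a, w a * f a) :
    ∃ ρ : ℝ, 0 ≤ ρ ∧ ρ < 1 ∧ ∀ (n : ℕ) (S : Set (Fin n → A)),
      (∀ a ∈ S, (∀ i, w (a i) ≠ 0) → ∑ i, f (a i) ≤ n * c) →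
      ∑ a, S.indicator (fun a => ∏ i, w (a i)) a ≤ ρ ^ n := by
  -- The moment generating function of c - f equals 1 at t = 0 and has derivative c - E f < 0 there,
  -- so it is below 1 at some t > 0. That value is ρ.
  have hd : HasDerivAt (fun t : ℝ => ∑ a, w a * Real.exp (t * (c - f a)))
      (∑ a, w a * (Real.exp (0 * (c - f a)) * (1 * (c - f a)))) 0 :=
    HasDerivAt.fun_sum fun a _ => (((hasDerivAt_id (0 : ℝ)).mul_const (c - f a)).exp).const_mul (w a)
  have hneg : ∑ a, w a * (Real.exp (0 * (c - f a)) * (1 * (c - f a))) < 0 := by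
    simp only [zero_mul, Real.exp_zero, one_mul]
    simp only [mul_sub, Finset.sum_sub_distrib, ← Finset.sum_mul, hw1]
    linarith
  have hs := (hasDerivAt_iff_tendsto_slope.1 hd).eventually (gt_mem_nhds hneg)
  have hs' := hs.filter_mono (nhdsWithin_mono (0 : ℝ) (fun t (ht : t ∈ Set.Ioi (0 : ℝ)) => ne_of_gt ht))
  obtain ⟨t, ht, ht0⟩ := (hs'.and self_mem_nhdsWithin).exists
  have ht0 : 0 < t := ht0
  have hlt : ∑ a, w a * Real.exp (t * (c - f a)) < 1 := by
    rw [slope_def_field, div_neg_iff] at ht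
    simp only [zero_mul, Real.exp_zero, mul_one, hw1] at ht
    rcases ht with h | h <;> linarith [h.1, h.2]
  refine ⟨_, Finset.sum_nonneg fun a _ => mul_nonneg (hw a) (Real.exp_pos _).le, hlt, ?_⟩
  intro n S hS
  have hpow : (∑ a, w a * Real.exp (t * (c - f a))) ^ n
      = ∑ a : Fin n → A, ∏ i, (w (a i) * Real.exp (t * (c - f (a i)))) := by
    rw [sum_pi_prod (fun (_ : Fin n) a => w a * Real.exp (t * (c - f a)))]
    simp
  rw [hpow]
  refine Finset.sum_le_sum fun a _ => ?_
  have hp : 0 ≤ ∏ i, w (a i) := Finset.prod_nonneg fun i _ => hw _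
  rw [Finset.prod_mul_distrib, ← Real.exp_sum, ← Finset.mul_sum]
  by_cases ha : a ∈ S
  · rw [Set.indicator_of_mem ha]
    by_cases h0 : ∀ i, w (a i) ≠ 0
    · refine le_mul_of_one_le_right hp (Real.one_le_exp (mul_nonneg ht0.le ?_))
      have := hS a ha h0
      simp only [Finset.sum_sub_distrib, Finset.sum_const, Finset.card_univ, Fintype.card_fin,
        nsmul_eq_mul]
      linarith
    · push Not at h0
      obtain ⟨i, hi⟩ := h0
      rw [Finset.prod_eq_zero (Finset.mem_univ i) hi, zero_mul]
  · rw [Set.indicator_of_notMem ha]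
    positivity

/-! ### Independent codewords: moments and concentration -/

section RandomCode

variable {K A : Type*} [Fintype K] [DecidableEq K] [Fintype A] {w : A → ℝ}

theorem sum_codebook_weight (hw1 : ∑ a, w a = 1) : ∑ c : K → A, ∏ k, w (c k) = 1 := by
  rw [sum_pi_prod (fun (_ : K) a => w a)]
  simp [hw1]

theorem sum_codebook_prod (hw1 : ∑ a, w a = 1) (s : Finset K) (f : K → A → ℝ) :
    ∑ c : K → A, (∏ k, w (c k)) * ∏ k ∈ s, f k (c k) = ∏ k ∈ s, ∑ a, w a * f k a := by
  have h := sum_pi_prod (fun (k : K) a => w a * if k ∈ s then f k a else 1)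
  have h2 : ∀ k, ∑ a, w a * (if k ∈ s then f k a else 1)
      = if k ∈ s then ∑ a, w a * f k a else 1 := by
    intro k
    by_cases hk : k ∈ s <;> simp [hk, hw1]
  simp only [h2, Finset.prod_mul_distrib] at h
  simpa [Finset.prod_ite_mem] using h

theorem sum_codebook_single (hw1 : ∑ a, w a = 1) (k : K) (f : A → ℝ) :
    ∑ c : K → A, (∏ k, w (c k)) * f (c k) = ∑ a, w a * f a := by
  simpa using sum_codebook_prod hw1 {k} (fun _ => f)

theorem sum_codebook_pair (hw1 : ∑ a, w a = 1) {k k' : K} (hk : k ≠ k') (f g : A → ℝ) :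
    ∑ c : K → A, (∏ k, w (c k)) * (f (c k) * g (c k'))
      = (∑ a, w a * f a) * ∑ a, w a * g a := by
  have h := sum_codebook_prod hw1 {k, k'} (fun j => if j = k then f else g)
  simpa [Finset.prod_pair hk, hk.symm] using h

/-- Chernoff bound for the upper tail of the sum of bounded functions of the codewords in a
sub-codebook. -/
theorem sum_codebook_upper_tail_le (hw : ∀ a, 0 ≤ w a) (hw1 : ∑ a, w a = 1) (s : Finset K)
    (f : A → ℝ) (hf0 : ∀ a, 0 ≤ f a) (hf1 : ∀ a, w a ≠ 0 → f a ≤ 1) {μ ε : ℝ}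
    (hμ : ∑ a, w a * f a ≤ μ) (hε : 0 ≤ ε) (hε1 : ε ≤ 1) :
    ∑ c : K → A, (∏ k, w (c k)) *
      {c : K → A | s.card * ((1 + ε) * μ) < ∑ k ∈ s, f (c k)}.indicator 1 c
      ≤ Real.exp (-(s.card * μ * ε ^ 2 / 4)) := by
  have hμ0 : 0 ≤ μ := le_trans (Finset.sum_nonneg fun a _ => mul_nonneg (hw a) (hf0 a)) hμ
  -- This t minimizes t² - tε, the exponent (per unit of expected sum) left after bounding exp t - 1
  -- by t + t²; the minimum is -ε²/4.
  set t := ε / 2 with ht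
  have ht0 : 0 ≤ t := by positivity
  have hmgf : ∑ a, w a * Real.exp (t * f a) ≤ Real.exp (μ * (Real.exp t - 1)) := by
    have hpt : ∀ a, w a * Real.exp (t * f a) ≤ w a + (w a * f a) * (Real.exp t - 1) := by
      intro a
      by_cases ha : w a = 0
      · simp [ha]
      -- On [0, t] the exponential lies below its chord, which is affine in f, so only a bound on
      -- the mean of f is needed.
      have hcv := convexOn_exp.2 (Set.mem_univ 0) (Set.mem_univ t)
        (sub_nonneg.2 (hf1 a ha)) (hf0 a) (by ring)
      simp only [smul_eq_mul, mul_zero, zero_add, Real.exp_zero, mul_one] at hcv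
      have := mul_le_mul_of_nonneg_left hcv (hw a)
      rw [mul_comm t]
      linarith
    calc ∑ a, w a * Real.exp (t * f a) ≤ ∑ a, (w a + (w a * f a) * (Real.exp t - 1)) :=
          Finset.sum_le_sum fun a _ => hpt a
      _ = 1 + (∑ a, w a * f a) * (Real.exp t - 1) := by
          rw [Finset.sum_add_distrib, hw1, Finset.sum_mul]
      _ ≤ 1 + μ * (Real.exp t - 1) := by
          have : 0 ≤ Real.exp t - 1 := sub_nonneg.2 (Real.one_le_exp ht0)
          gcongr
      _ ≤ _ := by rw [add_comm]; exact Real.add_one_le_exp _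
  have hexp : Real.exp t - 1 ≤ t + t ^ 2 := by
    have := Real.abs_exp_sub_one_sub_id_le (x := t) (by rw [abs_of_nonneg ht0]; linarith)
    linarith [(abs_le.1 this).2]
  have hm0 : 0 ≤ ∑ a, w a * Real.exp (t * f a) :=
    Finset.sum_nonneg fun a _ => mul_nonneg (hw a) (Real.exp_pos _).le
  calc _ ≤ ∑ c : K → A, (∏ k, w (c k)) * ((∏ k ∈ s, Real.exp (t * f (c k))) *
            Real.exp (-(t * (s.card * ((1 + ε) * μ))))) := by
        refine Finset.sum_le_sum fun c _ =>
          mul_le_mul_of_nonneg_left ?_ (Finset.prod_nonneg fun k _ => hw _)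
        rw [← Real.exp_sum, ← Finset.mul_sum, ← Real.exp_add]
        by_cases hc : s.card * ((1 + ε) * μ) < ∑ k ∈ s, f (c k)
        · rw [Set.indicator_of_mem (by exact hc)]
          refine Real.one_le_exp ?_
          nlinarith
        · rw [Set.indicator_of_notMem (by exact hc)]
          positivity
    _ = (∑ a, w a * Real.exp (t * f a)) ^ s.card *
            Real.exp (-(t * (s.card * ((1 + ε) * μ)))) := by
        have := sum_codebook_prod (K := K) hw1 s (fun _ a => Real.exp (t * f a))
        rw [Finset.prod_const] at this
        rw [← this, Finset.sum_mul]
        exact Finset.sum_congr rfl fun c _ => by ring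
    _ ≤ Real.exp (μ * (Real.exp t - 1)) ^ s.card *
            Real.exp (-(t * (s.card * ((1 + ε) * μ)))) := by gcongr
    _ ≤ _ := by
        rw [← Real.exp_nat_mul, ← Real.exp_add]
        refine Real.exp_le_exp.2 ?_
        have h1 : (s.card : ℝ) * (μ * (Real.exp t - 1)) ≤ s.card * (μ * (t + t ^ 2)) := by gcongr
        have h2 : (s.card : ℝ) * (μ * (t + t ^ 2)) + -(t * (s.card * ((1 + ε) * μ)))
          = -(s.card * μ * ε ^ 2 / 4) := by rw [ht]; ring
        linarith

end RandomCode

/-! ### Threshold decoding and one-shot random coding -/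

/-- The threshold decoder: the union bound on the event that the sent codeword fails the threshold
test or another codeword passes it. -/
theorem exists_decoder_sum_le {A B I J : Type*} [Fintype B] [Fintype I] [Fintype J]
    [DecidableEq I] [DecidableEq J] [Nonempty I] (V : A → B → ℝ) (T : B → ℝ) (hV : ∀ x y, 0 ≤ V x y)
    (c : I × J → A) :
    ∃ dec : B → I, ∑ k, ∑ y, V (c k) y * {y | dec y ≠ k.1}.indicator 1 y ≤
      ∑ k, ∑ y, V (c k) y * ({y | V (c k) y < T y}.indicator 1 y +
        ∑ k' ∈ Finset.univ.erase k, {x | T y ≤ V x y}.indicator 1 (c k')) := by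
  classical
  -- Any word passing the test may be chosen. If the sent word passes, an error forces the chosen
  -- word to be a different one that passes.
  refine ⟨fun y => if h : ∃ k, T y ≤ V (c k) y then h.choose.1 else Classical.arbitrary I, ?_⟩
  refine Finset.sum_le_sum fun k _ => Finset.sum_le_sum fun y _ =>
    mul_le_mul_of_nonneg_left ?_ (hV _ _)
  have hn : ∀ k' ∈ Finset.univ.erase k,
      (0 : ℝ) ≤ {x | T y ≤ V x y}.indicator (1 : A → ℝ) (c k') :=
    fun k' _ => Set.indicator_nonneg (fun _ _ => zero_le_one) _
  have hn' : (0 : ℝ) ≤ {y | V (c k) y < T y}.indicator (1 : B → ℝ) y :=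
    Set.indicator_nonneg (fun _ _ => zero_le_one) _
  rw [Set.indicator_apply]
  split_ifs with hy
  swap
  · exact add_nonneg hn' (Finset.sum_nonneg hn)
  rw [Pi.one_apply]
  by_cases hk : V (c k) y < T y
  · rw [Set.indicator_of_mem (by exact hk)]
    exact le_add_of_nonneg_right (Finset.sum_nonneg hn)
  · have h : ∃ k, T y ≤ V (c k) y := ⟨k, not_lt.1 hk⟩
    have hne : h.choose ≠ k := by
      intro he
      refine hy ?_
      simp only [dif_pos h, he]
    refine le_add_of_nonneg_of_le hn' ?_
    have := Finset.single_le_sum hn (Finset.mem_erase.2 ⟨hne, Finset.mem_univ _⟩)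
    rwa [Set.indicator_of_mem (by exact h.choose_spec)] at this

section OneShot

variable {A B C I J : Type*} [Fintype A] [Fintype B] [Fintype C] [Fintype I] [Fintype J]
  [DecidableEq I] [DecidableEq J] {w : A → ℝ}

/-- A word independent of y passes the test with probability at most a / τ: on passing, τ Q(y) ≤
V(x,y), and the mean of V(x,y) is at most a Q(y). Only domination by a Q is used, so Q need not be
the true output law; this leaves room for the conditioned input law. -/
theorem sum_codebook_error_le (hw : ∀ x, 0 ≤ w x) (hw1 : ∑ x, w x = 1) {K : Type*} [Fintype K]
    [DecidableEq K] (V : A → B → ℝ) (Q : B → ℝ) {a τ η : ℝ} (hV : ∀ x y, 0 ≤ V x y)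
    (hV1 : ∀ x, ∑ y, V x y = 1) (hVQ : ∀ y, ∑ x, w x * V x y ≤ a * Q y) (hQ : ∀ y, 0 ≤ Q y)
    (ha : 0 ≤ a) (hτ : 0 < τ)
    (hη : ∑ x, w x * ∑ y, V x y * {y | V x y < τ * Q y}.indicator 1 y ≤ η) :
    ∑ c : K → A, (∏ k, w (c k)) *
      ∑ k, ∑ y, V (c k) y * ({y | V (c k) y < τ * Q y}.indicator 1 y +
        ∑ k' ∈ Finset.univ.erase k, {x | τ * Q y ≤ V x y}.indicator 1 (c k')) ≤
      Fintype.card K * (η + Fintype.card K * (a / τ)) := by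
  have hpair : ∀ k : K, ∀ k' ∈ Finset.univ.erase k,
      ∑ y, ∑ c : K → A, (∏ k, w (c k)) *
        (V (c k) y * {x | τ * Q y ≤ V x y}.indicator 1 (c k')) ≤ a / τ := by
    intro k k' hk'
    have hne : k ≠ k' := (Finset.ne_of_mem_erase hk').symm
    have hy : ∀ y, ∑ c : K → A, (∏ k, w (c k)) *
        (V (c k) y * {x | τ * Q y ≤ V x y}.indicator 1 (c k')) ≤
        (∑ x, w x * V x y) * (a / τ) := by
      intro y
      have hp0 : 0 ≤ ∑ x, w x * V x y := Finset.sum_nonneg fun x _ => mul_nonneg (hw x) (hV x y)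
      rw [sum_codebook_pair hw1 hne (fun x => V x y) ({x | τ * Q y ≤ V x y}.indicator 1)]
      rcases (hQ y).eq_or_lt with h0 | h0
      -- If Q(y) = 0 every word passes the test, but such a y is never received.
      · have : ∑ x, w x * V x y = 0 := le_antisymm (by simpa [← h0] using hVQ y) hp0
        simp [this]
      · refine mul_le_mul_of_nonneg_left ?_ hp0
        rw [le_div_iff₀ hτ]
        refine le_of_mul_le_mul_right ?_ h0
        refine le_trans ?_ (hVQ y)
        rw [Finset.sum_mul, Finset.sum_mul]
        refine Finset.sum_le_sum fun x _ => ?_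
        rw [mul_assoc, mul_assoc]
        refine mul_le_mul_of_nonneg_left ?_ (hw x)
        by_cases hx : τ * Q y ≤ V x y
        · rw [Set.indicator_of_mem (by exact hx)]
          simpa using hx
        · rw [Set.indicator_of_notMem (by exact hx)]
          simpa using hV x y
    refine (Finset.sum_le_sum fun y _ => hy y).trans ?_
    rw [← Finset.sum_mul, Finset.sum_comm]
    simp [← Finset.mul_sum, hV1, hw1]
  have hk : ∀ k : K, ∑ c : K → A, (∏ k, w (c k)) *
      ∑ y, V (c k) y * ({y | V (c k) y < τ * Q y}.indicator 1 y +
        ∑ k' ∈ Finset.univ.erase k, {x | τ * Q y ≤ V x y}.indicator 1 (c k')) ≤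
      η + Fintype.card K * (a / τ) := by
    intro k
    simp only [mul_add, Finset.sum_add_distrib]
    refine add_le_add ?_ ?_
    · rwa [sum_codebook_single hw1 k
        (fun x => ∑ y, V x y * {y | V x y < τ * Q y}.indicator 1 y)]
    · calc _ = ∑ k' ∈ Finset.univ.erase k, ∑ y, ∑ c : K → A, (∏ k, w (c k)) *
            (V (c k) y * {x | τ * Q y ≤ V x y}.indicator 1 (c k')) := by
            simp only [Finset.mul_sum]
            rw [Finset.sum_comm' (t' := Finset.univ) (s' := fun _ => Finset.univ) (by simp),
              Finset.sum_comm' (s := Finset.univ.erase k) (t' := Finset.univ)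
                (s' := fun _ => Finset.univ.erase k) (by simp)]
            refine Finset.sum_congr rfl fun y _ => Finset.sum_comm
        _ ≤ ∑ k' ∈ Finset.univ.erase k, a / τ := Finset.sum_le_sum (hpair k)
        _ ≤ _ := by
            rw [Finset.sum_const, nsmul_eq_mul]
            have h : (Finset.univ.erase k).card ≤ Fintype.card K :=
              Finset.card_le_univ _
            have h0 : 0 ≤ a / τ := div_nonneg ha hτ.le
            gcongr
  refine (Finset.sum_congr rfl fun c _ => Finset.mul_sum _ _ _).trans_le ?_
  rw [Finset.sum_comm]
  refine (Finset.sum_le_sum fun k _ => hk k).trans ?_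
  simp [mul_add]

/-- One-shot random coding: a codebook that is reliable under threshold decoding and all of whose
sub-codebooks induce an output distribution at the eavesdropper dominated by a multiple of `q`. -/
theorem exists_codebook [Nonempty I] [Nonempty J] (hw : ∀ x, 0 ≤ w x) (hw1 : ∑ x, w x = 1)
    (V : A → B → ℝ) (Q : B → ℝ) (U : A → C → ℝ) (q : C → ℝ) {a τ η β ε e : ℝ}
    (hV : ∀ x y, 0 ≤ V x y) (hV1 : ∀ x, ∑ y, V x y = 1)
    (hVQ : ∀ y, ∑ x, w x * V x y ≤ a * Q y) (hQ : ∀ y, 0 ≤ Q y) (ha : 0 < a) (hτ : 0 < τ)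
    (hη : ∑ x, w x * ∑ y, V x y * {y | V x y < τ * Q y}.indicator 1 y ≤ η)
    (hU : ∀ x z, 0 ≤ U x z) (hq : ∀ z, 0 ≤ q z) (hUq : ∀ z, ∑ x, w x * U x z ≤ a * q z)
    (hβ : 0 < β) (hUβ : ∀ x z, w x ≠ 0 → U x z ≤ β * q z) (hε : 0 ≤ ε) (hε1 : ε ≤ 1) (he : 0 < e)
    (hsmall : η + Fintype.card I * Fintype.card J * (a / τ) +
      e * (Fintype.card I * Fintype.card C *
        Real.exp (-(Fintype.card J * (a / β) * ε ^ 2 / 4))) < e) :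
    ∃ (c : I × J → A) (dec : B → I),
      ∑ k, ∑ y, V (c k) y * {y | dec y ≠ k.1}.indicator 1 y ≤
        Fintype.card I * Fintype.card J * e ∧
      ∀ m z, ∑ j, U (c (m, j)) z ≤ Fintype.card J * ((1 + ε) * a * q z) := by
  set N : ℝ := Fintype.card I * Fintype.card J with hN
  have hN0 : 0 < N := by
    rw [hN]; exact_mod_cast Nat.mul_pos Fintype.card_pos Fintype.card_pos
  have hNK : ((Fintype.card (I × J) : ℕ) : ℝ) = N := by rw [Fintype.card_prod]; push_cast; rfl
  set s : I → Finset (I × J) := fun m => {m} ×ˢ Finset.univ with hs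
  have hcard : ∀ m, (s m).card = Fintype.card J := by intro m; simp [hs]
  -- Dividing by β q(z) puts the summands in [0, 1], as the Chernoff bound requires.
  set bad : I → C → Set (I × J → A) := fun m z =>
    {c | (s m).card * ((1 + ε) * (a / β)) < ∑ k ∈ s m, U (c k) z / (β * q z)} with hbad
  set err : (I × J → A) → ℝ := fun c =>
    ∑ k, ∑ y, V (c k) y * ({y | V (c k) y < τ * Q y}.indicator 1 y +
      ∑ k' ∈ Finset.univ.erase k, {x | τ * Q y ≤ V x y}.indicator 1 (c k')) with herr
  have hErr := sum_codebook_error_le (K := I × J) hw hw1 V Q hV hV1 hVQ hQ ha.le hτ hη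
  rw [hNK] at hErr
  have hBad1 : ∀ m z, ∑ c : I × J → A, (∏ k, w (c k)) * (bad m z).indicator 1 c
      ≤ Real.exp (-(Fintype.card J * (a / β) * ε ^ 2 / 4)) := by
    intro m z
    rw [← hcard m]
    refine sum_codebook_upper_tail_le hw hw1 (s m) (fun x => U x z / (β * q z))
      (fun x => div_nonneg (hU x z) (mul_nonneg hβ.le (hq z)))
      (fun x hx => div_le_one_of_le₀ (hUβ x z hx) (mul_nonneg hβ.le (hq z))) ?_ hε hε1
    rcases (hq z).eq_or_lt with h0 | h0
    · simp only [← h0, mul_zero, div_zero, Finset.sum_const_zero]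
      positivity
    · simp only [← mul_div_assoc, ← Finset.sum_div]
      rw [div_le_div_iff₀ (by positivity) hβ]
      nlinarith [mul_le_mul_of_nonneg_right (hUq z) hβ.le]
  have hBad : ∑ c : I × J → A, (∏ k, w (c k)) * ∑ m, ∑ z, (bad m z).indicator 1 c
      ≤ Fintype.card I * Fintype.card C *
        Real.exp (-(Fintype.card J * (a / β) * ε ^ 2 / 4)) := by
    simp only [Finset.mul_sum]
    rw [Finset.sum_comm]
    calc _ ≤ ∑ _m : I, ∑ _z : C, Real.exp (-(Fintype.card J * (a / β) * ε ^ 2 / 4)) := by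
          refine Finset.sum_le_sum fun m _ => ?_
          rw [Finset.sum_comm]
          exact Finset.sum_le_sum fun z _ => hBad1 m z
      _ = _ := by simp [mul_assoc]
  -- Each bad pair is charged N e, the whole error budget. A codebook whose total cost is below N e
  -- therefore has no bad pair and a small error.
  have hlt : ∑ c : I × J → A, (∏ k, w (c k)) *
      (err c + N * e * ∑ m, ∑ z, (bad m z).indicator 1 c) <
      ∑ c : I × J → A, (∏ k, w (c k)) * (N * e) := by
    rw [← Finset.sum_mul, sum_codebook_weight hw1, one_mul]
    simp only [mul_add, Finset.sum_add_distrib]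
    have h1 : ∑ c : I × J → A, (∏ k, w (c k)) * (N * e * ∑ m, ∑ z, (bad m z).indicator 1 c)
        = N * e * ∑ c : I × J → A, (∏ k, w (c k)) * ∑ m, ∑ z, (bad m z).indicator 1 c := by
      rw [Finset.mul_sum]
      exact Finset.sum_congr rfl fun c _ => by ring
    rw [h1]
    have h2 := mul_le_mul_of_nonneg_left hBad (mul_pos hN0 he).le
    have h3 := mul_lt_mul_of_pos_left hsmall hN0
    linarith
  obtain ⟨c, -, hc⟩ := Finset.exists_lt_of_sum_lt hlt
  have hc0 : 0 ≤ ∏ k, w (c k) := Finset.prod_nonneg fun k _ => hw _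
  have hc' := lt_of_mul_lt_mul_left hc hc0
  -- Strictness of the inequality forces positive weight. Hence every codeword lies in the support
  -- of w, which settles the outputs with q(z) = 0, where `bad` says nothing.
  have hcne : ∀ k, w (c k) ≠ 0 := by
    intro k hk
    rw [Finset.prod_eq_zero (Finset.mem_univ k) hk] at hc
    simp at hc
  have hi0 : ∀ m z, (0 : ℝ) ≤ (bad m z).indicator 1 c :=
    fun m z => Set.indicator_nonneg (fun _ _ => zero_le_one) _
  have herr0 : 0 ≤ err c := Finset.sum_nonneg fun k _ => Finset.sum_nonneg fun y _ =>
    mul_nonneg (hV _ _) (add_nonneg (Set.indicator_nonneg (fun _ _ => zero_le_one) _)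
      (Finset.sum_nonneg fun _ _ => Set.indicator_nonneg (fun _ _ => zero_le_one) _))
  have hNe : 0 < N * e := mul_pos hN0 he
  have hS0 : 0 ≤ ∑ m, ∑ z, (bad m z).indicator (1 : (I × J → A) → ℝ) c :=
    Finset.sum_nonneg fun m _ => Finset.sum_nonneg fun z _ => hi0 m z
  obtain ⟨dec, hdec⟩ := exists_decoder_sum_le V (fun y => τ * Q y) hV c
  refine ⟨c, dec, hdec.trans ?_, fun m z => ?_⟩
  · have := mul_nonneg hNe.le hS0
    exact (le_add_of_nonneg_right this).trans hc'.le
  · have hnb : c ∉ bad m z := by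
      intro hmem
      have h1 : (bad m z).indicator (1 : (I × J → A) → ℝ) c = 1 := by
        rw [Set.indicator_of_mem hmem]; rfl
      have h2 : (1 : ℝ) ≤ ∑ m, ∑ z, (bad m z).indicator (1 : (I × J → A) → ℝ) c := by
        rw [← h1]
        exact (Finset.single_le_sum (fun z _ => hi0 m z) (Finset.mem_univ z)).trans
          (Finset.single_le_sum (f := fun m => ∑ z, (bad m z).indicator (1 : (I × J → A) → ℝ) c)
            (fun m _ => Finset.sum_nonneg fun z _ => hi0 m z) (Finset.mem_univ m))
      have := mul_le_mul_of_nonneg_left h2 hNe.le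
      linarith
    rcases (hq z).eq_or_lt with h0 | h0
    · rw [← h0]
      refine (Finset.sum_nonpos fun j _ => ?_).trans (by simp)
      simpa [← h0] using hUβ (c (m, j)) z (hcne _)
    · simp only [hbad, Set.mem_ofPred_eq, not_lt, hcard] at hnb
      rw [← Finset.sum_div, div_le_iff₀ (by positivity)] at hnb
      simp only [hs, Finset.sum_product, Finset.sum_singleton] at hnb
      refine hnb.trans (le_of_eq ?_)
      field_simp

end OneShot

/-! ### Laws induced by a code -/

theorem piPMF_apply {α : Type*} [Fintype α] {n : ℕ} (p : Fin n → PMF α) (a : Fin n → α) :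
    piPMF p a = ∏ i, p i (a i) := rfl

/-- A coordinatewise image of a vector with independent coordinates has independent coordinates. -/
theorem piPMF_map {α β : Type*} [Fintype α] [Fintype β] {n : ℕ} (p : Fin n → PMF α) (f : α → β) :
    (piPMF p).map (fun a i => f (a i)) = piPMF fun i => (p i).map f := by
  classical
  ext b
  simp only [PMF.map_apply, tsum_fintype, piPMF_apply]
  rw [← sum_pi_prod (fun i a => if b i = f a then p i a else 0)]
  refine Finset.sum_congr rfl fun a _ => ?_
  rw [Finset.prod_ite_zero]
  simp [funext_iff]

theorem bind_map_pair_apply {α β : Type*} (p : PMF α) (q : α → PMF β) (a : α) (b : β) :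
    (p.bind fun a => (q a).map fun b => (a, b)) (a, b) = p a * q a b := by
  classical
  rw [PMF.bind_apply, tsum_eq_single a]
  · rw [PMF.map_apply, tsum_eq_single b]
    · simp
    · intro b' hb
      simp [hb.symm]
  · intro a' ha
    rw [PMF.map_apply]
    simp [ha.symm]

theorem indepPair_apply {α β : Type*} (p : PMF α) (q : PMF β) (a : α) (b : β) :
    indepPair p q (a, b) = p a * q b :=
  bind_map_pair_apply p (fun _ => q) a b

theorem sum_toReal_eq_one {α : Type*} [Fintype α] (p : PMF α) : ∑ a, (p a).toReal = 1 := by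
  rw [← ENNReal.toReal_sum fun a _ => p.apply_ne_top a, ← tsum_fintype (L := .unconditional α),
    p.tsum_coe, ENNReal.toReal_one]

section Code

variable {X Y Z : Type*} [Fintype Y] [Fintype Z] {n M : ℕ} [NeZero M]

theorem Code.leakLaw_apply (C : Code X Y n M) (W : X → PMF (Y × Z)) (m : Fin M) (z : Fin n → Z) :
    C.leakLaw W (m, z) = (M : ℝ≥0∞)⁻¹ *
      ((C.enc m).bind fun x => piPMF fun i => eveChannel W (x i)) z := by
  have h : C.leakLaw W = (PMF.uniformOfFintype (Fin M)).bind fun m =>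
      ((C.enc m).bind fun x => piPMF fun i => eveChannel W (x i)).map fun z => (m, z) := by
    simp only [Code.leakLaw, Code.law, PMF.map_bind, PMF.map_comp, eveChannel]
    congr 1; funext m; congr 1; funext x
    rw [← piPMF_map, PMF.map_comp]
    rfl
  rw [h, bind_map_pair_apply]
  simp

/-- The decoder sees only the first marginal of the channel, so the dependence between Y and Z plays
no role. -/
theorem Code.errorProb_eq (C : Code X Y n M) (W : X → PMF (Y × Z)) :
    C.errorProb W = ∑ m, (M : ℝ≥0∞)⁻¹ *
      ((C.enc m).bind fun x => piPMF fun i => (W (x i)).map Prod.fst).toOuterMeasure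
        {y | C.dec y ≠ m} := by
  simp only [Code.errorProb, Code.law, PMF.toOuterMeasure_bind_apply, tsum_fintype,
    PMF.uniformOfFintype_apply, Fintype.card_fin]
  refine Finset.sum_congr rfl fun m _ => ?_
  congr 1
  refine tsum_congr fun x => ?_
  rw [← piPMF_map, PMF.toOuterMeasure_map_apply, PMF.toOuterMeasure_map_apply]
  rfl

/-- The code that sends a uniformly chosen codeword of the sub-codebook of the message. -/
noncomputable def codebookCode {L : ℕ} [NeZero L] (c : Fin M × Fin L → Fin n → X)
    (dec : (Fin n → Y) → Fin M) : Code X Y n M where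
  enc m := (PMF.uniformOfFintype (Fin L)).map fun l => c (m, l)
  dec := dec

variable {L : ℕ} [NeZero L] (c : Fin M × Fin L → Fin n → X) (dec : (Fin n → Y) → Fin M)
  (W : X → PMF (Y × Z))

theorem codebookCode_leakLaw_apply (m : Fin M) (z : Fin n → Z) :
    (codebookCode c dec).leakLaw W (m, z) = (M : ℝ≥0∞)⁻¹ *
      ((L : ℝ≥0∞)⁻¹ * ∑ l, ∏ i, eveChannel W (c (m, l) i) (z i)) := by
  rw [Code.leakLaw_apply]
  simp only [codebookCode, PMF.bind_map]
  rw [PMF.bind_apply, tsum_fintype]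
  simp [piPMF_apply, Finset.mul_sum]

theorem codebookCode_errorProb : (codebookCode c dec).errorProb W =
    ENNReal.ofReal ((∑ k, ∑ y : Fin n → Y, (∏ i, ((W (c k i)).map Prod.fst (y i)).toReal) *
      {y | dec y ≠ k.1}.indicator 1 y) / (M * L)) := by
  have hM : (M : ℝ≥0∞) ≠ 0 := Nat.cast_ne_zero.2 (NeZero.ne M)
  have hL : (L : ℝ≥0∞) ≠ 0 := Nat.cast_ne_zero.2 (NeZero.ne L)
  have h0 : ∀ (k : Fin M × Fin L) (y : Fin n → Y), 0 ≤
      (∏ i, ((W (c k i)).map Prod.fst (y i)).toReal) *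
        {y | dec y ≠ k.1}.indicator (1 : (Fin n → Y) → ℝ) y := fun k y =>
    mul_nonneg (Finset.prod_nonneg fun i _ => ENNReal.toReal_nonneg)
      (Set.indicator_nonneg (fun _ _ => zero_le_one) _)
  rw [Code.errorProb_eq, ENNReal.ofReal_div_of_pos
    (by exact_mod_cast Nat.mul_pos (NeZero.pos M) (NeZero.pos L)),
    ENNReal.ofReal_mul (Nat.cast_nonneg M), ENNReal.ofReal_natCast, ENNReal.ofReal_natCast,
    div_eq_mul_inv, ENNReal.mul_inv (Or.inl hM) (Or.inr hL),
    ENNReal.ofReal_sum_of_nonneg fun k _ => Finset.sum_nonneg fun y _ => h0 k y,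
    Fintype.sum_prod_type, Finset.sum_mul]
  refine Finset.sum_congr rfl fun m _ => ?_
  rw [Finset.sum_mul]
  simp only [codebookCode, PMF.bind_map, PMF.toOuterMeasure_bind_apply, tsum_fintype,
    PMF.uniformOfFintype_apply, Fintype.card_fin, Finset.mul_sum]
  refine Finset.sum_congr rfl fun l _ => ?_
  rw [← mul_assoc, mul_comm]
  congr 1
  rw [Function.comp_apply, PMF.toOuterMeasure_apply_fintype,
    ENNReal.ofReal_sum_of_nonneg fun y _ => h0 (m, l) y]
  refine Finset.sum_congr rfl fun y _ => ?_
  by_cases hy : dec y ≠ m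
  · rw [Set.indicator_of_mem (by exact hy), Set.indicator_of_mem (by exact hy), Pi.one_apply,
      mul_one, piPMF_apply, ENNReal.ofReal_prod_of_nonneg fun i _ => ENNReal.toReal_nonneg]
    exact Finset.prod_congr rfl fun i _ => (ENNReal.ofReal_toReal (PMF.apply_ne_top _ _)).symm
  · rw [Set.indicator_of_notMem (by exact hy), Set.indicator_of_notMem (by exact hy)]
    simp

end Code

/-! ### Divergence of order infinity -/

section Divergence

variable {α : Type*} (p q : PMF α)

/-- If the supremum were s < 1, summing p ≤ s q would give 1 ≤ s. -/
theorem one_le_iSup_div : 1 ≤ ⨆ a, p a / q a := by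
  by_contra! h
  have hle : ∀ a, p a ≤ (⨆ a, p a / q a) * q a := fun a =>
    (ENNReal.div_le_iff_le_mul (Or.inr (h.trans ENNReal.one_lt_top).ne)
      (Or.inl (q.apply_ne_top a))).1 (le_iSup (fun a => p a / q a) a)
  have h2 := ENNReal.tsum_le_tsum hle
  rw [ENNReal.tsum_mul_left, p.tsum_coe, q.tsum_coe, mul_one] at h2
  exact absurd h2 (not_le.2 h)

theorem dInf_self : dInf p p = 0 := by
  have h : ⨆ a, p a / p a = 1 :=
    le_antisymm (iSup_le fun a => ENNReal.div_self_le_one) (one_le_iSup_div p p)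
  rw [dInf, h, ENNReal.log_one, EReal.zero_div]

variable {p q}

/-- The order-infinity divergence is a nonnegative real number once `p` is dominated by a finite
multiple of `q`, and it is then the logarithm of a valid multiple. -/
theorem exists_dInf_eq_coe {c : ℝ≥0∞} (hc : c ≠ ∞) (h : ∀ a, p a ≤ c * q a) :
    ∃ d : ℝ, 0 ≤ d ∧ dInf p q = d ∧
      ∀ a, (p a).toReal ≤ Real.exp (d * Real.log 2) * (q a).toReal := by
  set s := ⨆ a, p a / q a with hs
  have h2 : 0 < Real.log 2 := Real.log_pos one_lt_two
  have hst : s ≠ ∞ := ne_top_of_le_ne_top hc (iSup_le fun a => ENNReal.div_le_of_le_mul (h a))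
  have h1 : 1 ≤ s := one_le_iSup_div p q
  have h1' : 1 ≤ s.toReal := by
    simpa using ENNReal.toReal_mono hst h1
  refine ⟨Real.log s.toReal / Real.log 2, div_nonneg (Real.log_nonneg h1') h2.le, ?_, fun a => ?_⟩
  · rw [dInf, ← hs, ENNReal.log_pos_real (by positivity) hst, EReal.coe_div]
  · rw [div_mul_cancel₀ _ h2.ne', Real.exp_log (by linarith), ← ENNReal.toReal_mul]
    exact ENNReal.toReal_mono (ENNReal.mul_ne_top hst (q.apply_ne_top a))
      ((ENNReal.div_le_iff_le_mul (Or.inr hst) (Or.inl (q.apply_ne_top a))).1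
        (le_iSup (fun a => p a / q a) a))

theorem tendsto_dInf_zero {ι : Type*} {l : Filter ι} {α : ι → Type*} {p q : ∀ i, PMF (α i)}
    (h : Tendsto (fun i => ⨆ a, p i a / q i a) l (𝓝 1)) :
    Tendsto (fun i => dInf (p i) (q i)) l (𝓝 0) := by
  have h1 := (ENNReal.continuous_log.tendsto 1).comp h
  rw [ENNReal.log_one] at h1
  have h2 := EReal.Tendsto.mul_const (b := ((Real.log 2 : ℝ) : EReal)⁻¹) h1
    (Or.inr (by rw [← EReal.coe_inv]; exact EReal.coe_ne_bot _))
    (Or.inr (by rw [← EReal.coe_inv]; exact EReal.coe_ne_top _))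
  rwa [zero_mul] at h2

end Divergence

/-! ### Exponents for large block length -/

theorem eventually_linear_sub_exp_le (κ : ℝ) {s δ : ℝ} (hs : 0 < s) (hδ : 0 < δ) :
    ∀ᶠ n : ℕ in atTop, n * κ - s * Real.exp (n * δ) ≤ -n := by
  have h := ((tendsto_exp_mul_div_rpow_atTop 1 δ hδ).comp
    tendsto_natCast_atTop_atTop).eventually_ge_atTop ((κ + 1) / s)
  filter_upwards [h, eventually_gt_atTop 0] with n hn hn0
  have hn0' : (0 : ℝ) < n := by exact_mod_cast hn0
  simp only [Function.comp_apply, Real.rpow_one] at hn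
  rw [div_le_div_iff₀ hs hn0'] at hn
  rw [mul_comm (n : ℝ) δ]
  linarith

theorem sum_pair_sequences {X Y : Type*} [Fintype X] [Fintype Y] {n : ℕ}
    (g : (Fin n → X) → (Fin n → Y) → ℝ) :
    ∑ x, ∑ y, g x y = ∑ a : Fin n → X × Y, g (fun i => (a i).1) (fun i => (a i).2) := by
  rw [← Fintype.sum_prod_type']
  exact (Fintype.sum_equiv (Equiv.arrowProdEquivProdArrow (Fin n) (fun _ => X) (fun _ => Y)) _ _
    fun a => rfl).symm

section Asymptotics

variable {X Y Z : Type*} [Fintype X] [Fintype Y] [Fintype Z]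

/-- The threshold test at a level below the mutual information fails with exponentially small
probability. -/
theorem exists_threshold_failure_le (P : X → ℝ) (V : X → Y → ℝ) (Q : Y → ℝ) (hP : ∀ x, 0 ≤ P x)
    (hP1 : ∑ x, P x = 1) (hV : ∀ x y, 0 ≤ V x y) (hV1 : ∀ x, ∑ y, V x y = 1)
    (hQ : ∀ y, Q y = ∑ x, P x * V x y) {γ : ℝ}
    (hγ : γ < ∑ x, ∑ y, P x * V x y * Real.log (V x y / Q y)) :
    ∃ ρ : ℝ, 0 ≤ ρ ∧ ρ < 1 ∧ ∀ n : ℕ,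
      ∑ x : Fin n → X, (∏ i, P (x i)) * ∑ y : Fin n → Y, (∏ i, V (x i) (y i)) *
        {y : Fin n → Y | ∏ i, V (x i) (y i) < Real.exp (n * γ) * ∏ i, Q (y i)}.indicator 1 y
        ≤ ρ ^ n := by
  -- The log-likelihood ratio of a letter pair has mean equal to the mutual information, so a level
  -- γ below it is missed exponentially rarely.
  obtain ⟨ρ, h0, h1, h⟩ := exists_lower_tail_le (A := X × Y) (fun a => P a.1 * V a.1 a.2)
    (fun a => Real.log (V a.1 a.2 / Q a.2)) γ (fun a => mul_nonneg (hP _) (hV _ _))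
    (by simp [Fintype.sum_prod_type, ← Finset.mul_sum, hV1, hP1])
    (by simpa [Fintype.sum_prod_type] using hγ)
  refine ⟨ρ, h0, h1, fun n => ?_⟩
  refine le_trans (le_of_eq ?_) (h n {a | ∏ i, V (a i).1 (a i).2 <
    Real.exp (n * γ) * ∏ i, Q (a i).2} ?_)
  · simp only [Finset.mul_sum]
    rw [sum_pair_sequences]
    refine Finset.sum_congr rfl fun a _ => ?_
    simp [Set.indicator_apply, Finset.prod_mul_distrib]
  · intro a ha hne
    have hVpos : ∀ i, 0 < V (a i).1 (a i).2 := fun i =>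
      lt_of_le_of_ne (hV _ _) (right_ne_zero_of_mul (hne i)).symm
    have hQpos : ∀ i, 0 < Q (a i).2 := fun i => by
      rw [hQ]
      exact lt_of_lt_of_le (lt_of_le_of_ne (mul_nonneg (hP _) (hV _ _)) (hne i).symm)
        (Finset.single_le_sum (f := fun x => P x * V x (a i).2)
          (fun x _ => mul_nonneg (hP x) (hV _ _)) (Finset.mem_univ (a i).1))
    rw [← Real.log_prod fun i _ => (div_pos (hVpos i) (hQpos i)).ne', Finset.prod_div_distrib,
      ← Real.log_exp (n * γ)]
    have hp : 0 < ∏ i, Q (a i).2 := Finset.prod_pos fun i _ => hQpos i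
    refine Real.log_le_log (div_pos (Finset.prod_pos fun i _ => hVpos i) hp) ?_
    rw [div_le_iff₀ hp]
    exact le_of_lt ha

/-- A memoryless input law conditioned on the typical event that the order-infinity divergences of
the letters add up to little more than their expectation. -/
theorem eventually_exists_conditioned_law (P d : X → ℝ) (hP : ∀ x, 0 ≤ P x)
    (hP1 : ∑ x, P x = 1) {D a : ℝ} (hD : ∑ x, P x * d x < D) (ha : 1 < a) :
    ∀ᶠ n : ℕ in atTop, ∃ w : (Fin n → X) → ℝ, (∀ x, 0 ≤ w x) ∧ ∑ x, w x = 1 ∧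
      (∀ x, w x ≤ a * ∏ i, P (x i)) ∧ ∀ x, w x ≠ 0 → ∑ i, d (x i) ≤ n * D := by
  obtain ⟨ρ, h0, h1, h⟩ := exists_lower_tail_le P (fun x => -d x) (-D) hP hP1
    (by simpa using neg_lt_neg hD)
  have ha0 : 0 < a := by linarith
  have hlt : a⁻¹ < 1 := inv_lt_one_of_one_lt₀ ha
  -- The typical event eventually has probability at least 1/a, so conditioning on it multiplies
  -- masses by at most a.
  filter_upwards [(tendsto_pow_atTop_nhds_zero_of_lt_one h0 h1).eventually
    (gt_mem_nhds (sub_pos.2 hlt))] with n hn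
  set T : Set (Fin n → X) := {x | ∑ i, d (x i) ≤ n * D} with hT
  set w0 : (Fin n → X) → ℝ := fun x => ∏ i, P (x i) with hw0
  have hw00 : ∀ x, 0 ≤ w0 x := fun x => Finset.prod_nonneg fun i _ => hP _
  have hc := h n Tᶜ (fun x hx _ => by
    have hx : ¬ ∑ i, d (x i) ≤ n * D := hx
    rw [Finset.sum_neg_distrib]
    linarith)
  have hsum : ∑ x, T.indicator w0 x + ∑ x, Tᶜ.indicator w0 x = 1 := by
    rw [← Finset.sum_add_distrib, ← sum_codebook_weight (K := Fin n) hP1]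
    exact Finset.sum_congr rfl fun x _ => congrFun (Set.indicator_self_add_compl T w0) x
  set PT := ∑ x, T.indicator w0 x with hPT
  have hPTa : a⁻¹ ≤ PT := by linarith
  have hPT0 : 0 < PT := lt_of_lt_of_le (inv_pos.2 ha0) hPTa
  refine ⟨fun x => T.indicator w0 x / PT,
    fun x => div_nonneg (Set.indicator_nonneg (fun x _ => hw00 x) x) hPT0.le,
    by rw [← Finset.sum_div, div_self hPT0.ne'], fun x => ?_, fun x hx => ?_⟩
  · rw [div_le_iff₀ hPT0]
    refine (Set.indicator_le_self' (fun x _ => hw00 x) x).trans ?_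
    have : 1 ≤ a * PT := by
      have := mul_le_mul_of_nonneg_left hPTa ha0.le
      rwa [mul_inv_cancel₀ ha0.ne'] at this
    nlinarith [hw00 x]
  · by_contra hxT
    refine hx ?_
    simp only [Set.indicator_of_notMem (show x ∉ T from hxT), zero_div]

/-- An input law dominated by a multiple of a memoryless law induces an output law dominated by the
same multiple of the memoryless output law. -/
theorem sum_dominated_mul_le {A B : Type*} [Fintype A] {P : A → ℝ} {K : A → B → ℝ} {r : B → ℝ}
    {n : ℕ} {w : (Fin n → A) → ℝ} {a : ℝ} (hwa : ∀ x, w x ≤ a * ∏ i, P (x i))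
    (hK : ∀ x b, 0 ≤ K x b) (hr : ∀ b, r b = ∑ x, P x * K x b) (b : Fin n → B) :
    ∑ x, w x * ∏ i, K (x i) (b i) ≤ a * ∏ i, r (b i) := by
  simp only [hr]
  rw [← sum_pi_prod (fun (i : Fin n) x => P x * K x (b i)), Finset.mul_sum]
  refine Finset.sum_le_sum fun x _ => ?_
  rw [Finset.prod_mul_distrib, ← mul_assoc]
  exact mul_le_mul_of_nonneg_right (hwa x) (Finset.prod_nonneg fun i _ => hK _ _)

/-- Reliable and secret codebooks exist for all large block lengths. -/
theorem eventually_exists_codebook (P d : X → ℝ) (V : X → Y → ℝ) (U : X → Z → ℝ) (Q : Y → ℝ)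
    (q : Z → ℝ) (hP : ∀ x, 0 ≤ P x) (hP1 : ∑ x, P x = 1) (hV : ∀ x y, 0 ≤ V x y)
    (hV1 : ∀ x, ∑ y, V x y = 1) (hQ : ∀ y, Q y = ∑ x, P x * V x y) (hU : ∀ x z, 0 ≤ U x z)
    (hq : ∀ z, q z = ∑ x, P x * U x z) (hd : ∀ x, 0 ≤ d x)
    (hdU : ∀ x z, P x ≠ 0 → U x z ≤ Real.exp (d x) * q z) {R : ℝ}
    (hR : R + ∑ x, P x * d x < ∑ x, ∑ y, P x * V x y * Real.log (V x y / Q y))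
    (M : ℕ → ℕ) (hM0 : ∀ n, 0 < M n) (hM : ∀ n, (M n : ℝ) ≤ 2 * Real.exp (n * R))
    {ε : ℝ} (hε : 0 < ε) (hε1 : ε ≤ 1) :
    ∀ᶠ n : ℕ in atTop, ∃ L : ℕ, 0 < L ∧ ∃ (c : Fin (M n) × Fin L → Fin n → X)
      (dec : (Fin n → Y) → Fin (M n)),
      ∑ k, ∑ y : Fin n → Y, (∏ i, V (c k i) (y i)) * {y | dec y ≠ k.1}.indicator 1 y ≤
        M n * L * ε ∧
      ∀ m (z : Fin n → Z), ∑ j, ∏ i, U (c (m, j) i) (z i) ≤ L * ((1 + ε) ^ 2 * ∏ i, q (z i)) := by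
  set D := ∑ x, P x * d x with hD
  set J := ∑ x, ∑ y, P x * V x y * Real.log (V x y / Q y) with hJ
  -- The gap 4δ is spent as follows: β has exponent D+δ, L has D+2δ and the threshold has J-δ. This
  -- leaves δ of margin for secrecy (L/β) and δ for decoding.
  obtain ⟨δ, hδ, hδJ⟩ : ∃ δ : ℝ, 0 < δ ∧ J = R + D + 4 * δ :=
    ⟨(J - R - D) / 4, by linarith, by ring⟩
  have hD0 : 0 ≤ D := Finset.sum_nonneg fun x _ => mul_nonneg (hP x) (hd x)
  obtain ⟨ρ, hρ0, hρ1, hρ⟩ := exists_threshold_failure_le P V Q hP hP1 hV hV1 hQ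
    (γ := J - δ) (by linarith)
  set a := 1 + ε with ha
  have ha0 : 0 < a := by linarith
  have ha1 : 1 ≤ a := by linarith
  have hs : 0 < ε ^ 2 / 4 := by positivity
  -- The terms bound the failure of the sent word, the passing of a wrong word, and ε times the
  -- expected number of secrecy violations.
  have hlim : Tendsto (fun n : ℕ => a * ρ ^ n + 4 * a * Real.exp (-δ) ^ n +
      ε * (2 * Real.exp (-1) ^ n)) atTop (𝓝 0) := by
    have h1 := (tendsto_pow_atTop_nhds_zero_of_lt_one hρ0 hρ1).const_mul a
    have h2 := (tendsto_pow_atTop_nhds_zero_of_lt_one (Real.exp_pos (-δ)).le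
      (Real.exp_lt_one_iff.2 (by linarith : -δ < 0))).const_mul (4 * a)
    have h3 := ((tendsto_pow_atTop_nhds_zero_of_lt_one (Real.exp_pos (-1)).le
      (Real.exp_lt_one_iff.2 (by norm_num : (-1 : ℝ) < 0))).const_mul 2).const_mul ε
    simpa using (h1.add h2).add h3
  filter_upwards [eventually_exists_conditioned_law P d hP hP1
      (show ∑ x, P x * d x < D + δ by linarith) (show 1 < a by linarith),
    hlim.eventually (gt_mem_nhds hε),
    eventually_linear_sub_exp_le (R + Fintype.card Z) hs hδ] with n hw hsmall hlin
  obtain ⟨w, hw0, hw1, hwa, hwd⟩ := hw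
  set L : ℕ := ⌈Real.exp (n * (D + 2 * δ))⌉₊ with hL
  have hL0 : 0 < L := Nat.ceil_pos.2 (Real.exp_pos _)
  have hL1 : Real.exp (n * (D + 2 * δ)) ≤ L := Nat.le_ceil _
  have hL2 : (L : ℝ) ≤ 2 * Real.exp (n * (D + 2 * δ)) := by
    have h1 := (Nat.ceil_lt_add_one (Real.exp_pos (n * (D + 2 * δ))).le).le
    have h2 : 1 ≤ Real.exp (n * (D + 2 * δ)) := Real.one_le_exp (by positivity)
    linarith
  have hq0 : ∀ z, 0 ≤ q z := fun z => by
    rw [hq]; exact Finset.sum_nonneg fun x _ => mul_nonneg (hP x) (hU x z)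
  have hQ0 : ∀ y, 0 ≤ Q y := fun y => by
    rw [hQ]; exact Finset.sum_nonneg fun x _ => mul_nonneg (hP x) (hV x y)
  have hwP : ∀ x i, w x ≠ 0 → P (x i) ≠ 0 := by
    intro x i hx h0
    have := hwa x
    rw [Finset.prod_eq_zero (Finset.mem_univ i) h0, mul_zero] at this
    exact hx (le_antisymm this (hw0 x))
  have : Nonempty (Fin (M n)) := ⟨⟨0, hM0 n⟩⟩
  have : Nonempty (Fin L) := ⟨⟨0, hL0⟩⟩
  obtain ⟨c, dec, h1, h2⟩ := exists_codebook (I := Fin (M n)) (J := Fin L) hw0 hw1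
    (fun x (y : Fin n → Y) => ∏ i, V (x i) (y i)) (fun y => ∏ i, Q (y i))
    (fun x (z : Fin n → Z) => ∏ i, U (x i) (z i)) (fun z => ∏ i, q (z i))
    (a := a) (τ := Real.exp (n * (J - δ))) (η := a * ρ ^ n) (β := Real.exp (n * (D + δ)))
    (ε := ε) (e := ε) (fun x y => Finset.prod_nonneg fun i _ => hV _ _)
    (fun x => by rw [sum_pi_prod (fun i y => V (x i) y)]; simp [hV1])
    (fun y => sum_dominated_mul_le hwa hV hQ y) (fun y => Finset.prod_nonneg fun i _ => hQ0 _) ha0 (Real.exp_pos _)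
    (by
      refine le_trans ?_ (mul_le_mul_of_nonneg_left (hρ n) ha0.le)
      rw [Finset.mul_sum]
      refine Finset.sum_le_sum fun x _ => ?_
      rw [← mul_assoc]
      exact mul_le_mul_of_nonneg_right (hwa x) (Finset.sum_nonneg fun y _ => mul_nonneg
        (Finset.prod_nonneg fun i _ => hV _ _) (Set.indicator_nonneg (fun _ _ => zero_le_one) _)))
    (fun x z => Finset.prod_nonneg fun i _ => hU _ _)
    (fun z => Finset.prod_nonneg fun i _ => hq0 _) (fun z => sum_dominated_mul_le hwa hU hq z) (Real.exp_pos _)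
    (fun x z hx => by
      calc ∏ i, U (x i) (z i) ≤ ∏ i, (Real.exp (d (x i)) * q (z i)) :=
            Finset.prod_le_prod (fun i _ => hU _ _) fun i _ => hdU _ _ (hwP x i hx)
        _ = Real.exp (∑ i, d (x i)) * ∏ i, q (z i) := by
            rw [Finset.prod_mul_distrib, Real.exp_sum]
        _ ≤ _ := mul_le_mul_of_nonneg_right (Real.exp_le_exp.2 (hwd x hx))
            (Finset.prod_nonneg fun i _ => hq0 _))
    hε.le hε1 hε
    (by
      refine lt_of_le_of_lt ?_ hsmall
      simp only [Fintype.card_fin, Fintype.card_pi, Finset.prod_const, Finset.card_univ]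
      refine add_le_add (add_le_add le_rfl ?_) (mul_le_mul_of_nonneg_left ?_ hε.le)
      · calc (M n : ℝ) * L * (a / Real.exp (n * (J - δ)))
            ≤ (2 * Real.exp (n * R)) * (2 * Real.exp (n * (D + 2 * δ))) *
              (a / Real.exp (n * (J - δ))) := by
              gcongr
              exact hM n
          _ = 4 * a * (Real.exp (n * R) * Real.exp (n * (D + 2 * δ)) *
              Real.exp (-(n * (J - δ)))) := by rw [Real.exp_neg]; ring
          _ = 4 * a * Real.exp (-δ) ^ n := by
              rw [← Real.exp_add, ← Real.exp_add, ← Real.exp_nat_mul, hδJ]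
              congr 2
              ring
      -- The crude bound |Z| ≤ exp |Z| suffices, since any linear exponent loses to exp(nδ).
      · have hZ : ((Fintype.card Z ^ n : ℕ) : ℝ) ≤ Real.exp (n * Fintype.card Z) := by
          rw [Real.exp_nat_mul]
          push_cast
          gcongr
          linarith [Real.add_one_le_exp (Fintype.card Z : ℝ)]
        have hLβ : Real.exp (n * δ) ≤ L * (a / Real.exp (n * (D + δ))) := by
          rw [← mul_div_assoc, le_div_iff₀ (Real.exp_pos _), ← Real.exp_add]
          have : (n : ℝ) * δ + n * (D + δ) = n * (D + 2 * δ) := by ring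
          rw [this]
          nlinarith
        calc (M n : ℝ) * ((Fintype.card Z ^ n : ℕ) : ℝ) *
              Real.exp (-(L * (a / Real.exp (n * (D + δ))) * ε ^ 2 / 4))
            ≤ (2 * Real.exp (n * R)) * Real.exp (n * Fintype.card Z) *
              Real.exp (-(ε ^ 2 / 4 * Real.exp (n * δ))) := by
              gcongr
              · exact hM n
              · rw [mul_div_assoc, mul_comm]
                gcongr
          _ = 2 * Real.exp (n * (R + Fintype.card Z) - ε ^ 2 / 4 * Real.exp (n * δ)) := by
              rw [mul_assoc, mul_assoc, ← Real.exp_add, ← Real.exp_add]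
              congr 2
              ring
          _ ≤ 2 * Real.exp (-1) ^ n := by
              rw [← Real.exp_nat_mul]
              gcongr
              simpa using hlin)
  refine ⟨L, hL0, c, dec, by simpa using h1, fun m z => ?_⟩
  have := h2 m z
  rwa [Fintype.card_fin, ← pow_two a] at this

end Asymptotics

/-! ### From codebooks to a sequence of codes -/

/-- A diagonal choice: pointwise eventual smallness for each tolerance yields a single sequence
converging to zero. -/
theorem exists_seq_tendsto_zero {β : ℕ → Type*} [∀ n, Nonempty (β n)] (F : ∀ n, β n → ℝ≥0∞)
    (h : ∀ ε : ℝ≥0∞, 0 < ε → ∀ᶠ n in atTop, ∃ b : β n, F n b ≤ ε) :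
    ∃ b : ∀ n, β n, Tendsto (fun n => F n (b n)) atTop (𝓝 0) := by
  -- A near-minimizer at each n serves all tolerances at once.
  have hex : ∀ n, ∃ b : β n, F n b ≤ (⨅ b, F n b) + ((n : ℝ≥0∞) + 1)⁻¹ := by
    intro n
    by_cases ht : (⨅ b, F n b) = ∞
    · exact ⟨Classical.arbitrary _, by simp [ht]⟩
    · have hlt : (⨅ b, F n b) < (⨅ b, F n b) + ((n : ℝ≥0∞) + 1)⁻¹ :=
        ENNReal.lt_add_right ht (ENNReal.inv_ne_zero.2 (by finiteness))
      obtain ⟨b, hb⟩ := iInf_lt_iff.1 hlt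
      exact ⟨b, hb.le⟩
  choose b hb using hex
  have h1 : Tendsto (fun n => ⨅ b, F n b) atTop (𝓝 0) := by
    rw [ENNReal.tendsto_nhds_zero]
    intro ε hε
    filter_upwards [h ε hε] with n ⟨b, hb⟩
    exact (iInf_le _ b).trans hb
  have h2 : Tendsto (fun n : ℕ => ((n : ℝ≥0∞) + 1)⁻¹) atTop (𝓝 0) := by
    have := ENNReal.tendsto_inv_nat_nhds_zero.comp (tendsto_add_atTop_nat 1)
    simpa [Function.comp_def] using this
  refine ⟨b, tendsto_of_tendsto_of_tendsto_of_le_of_le tendsto_const_nhds ?_ (fun n => zero_le)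
    hb⟩
  simpa using h1.add h2

theorem numMessages_of_nonpos {R : ℝ} (hR : R ≤ 0) (n : ℕ) : numMessages R n = 1 := by
  refine le_antisymm (Nat.ceil_le.2 ?_) (NeZero.pos (numMessages R n))
  rw [Nat.cast_one]
  exact Real.rpow_le_one_of_one_le_of_nonpos one_le_two
    (mul_nonpos_of_nonneg_of_nonpos (Nat.cast_nonneg n) hR)

theorem numMessages_le {R : ℝ} (hR : 0 ≤ R) (n : ℕ) :
    (numMessages R n : ℝ) ≤ 2 * Real.exp (n * (R * Real.log 2)) := by
  have h : (2 : ℝ) ^ ((n : ℝ) * R) = Real.exp (n * (R * Real.log 2)) := by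
    rw [Real.rpow_def_of_pos two_pos]
    ring_nf
  have h1 : 1 ≤ Real.exp (n * (R * Real.log 2)) :=
    Real.one_le_exp (mul_nonneg (Nat.cast_nonneg n) (mul_nonneg hR (Real.log_pos one_lt_two).le))
  have h2 := (Nat.ceil_lt_add_one (Real.exp_pos (n * (R * Real.log 2))).le).le
  rw [numMessages, h]
  linarith

/-- A memoryless input law induces a memoryless output law. -/
theorem piPMF_bind {α β : Type*} [Fintype α] [Fintype β] {n : ℕ} (p : PMF α) (K : α → PMF β) :
    ((piPMF fun _ : Fin n => p).bind fun x => piPMF fun i => K (x i)) =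
      piPMF fun _ => p.bind K := by
  ext z
  simp only [PMF.bind_apply, tsum_fintype, piPMF_apply, ← Finset.prod_mul_distrib]
  exact sum_pi_prod (fun i x => p x * K x (z i))

theorem eveLaw_toReal {X Y Z : Type*} [Fintype X] (p : PMF X) (W : X → PMF (Y × Z)) (z : Z) :
    (eveLaw p W z).toReal = ∑ x, (p x).toReal * (eveChannel W x z).toReal := by
  rw [eveLaw, PMF.bind_apply, tsum_fintype, ENNReal.toReal_sum
    fun x _ => ENNReal.mul_ne_top (p.apply_ne_top x) (PMF.apply_ne_top _ z)]
  simp only [ENNReal.toReal_mul]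

/-- The divergences of the letters in the support of the input law are real numbers. -/
theorem exists_letter_divergence {X Y Z : Type*} [Fintype X] (p : PMF X)
    (W : X → PMF (Y × Z)) : ∃ d : X → ℝ, (∀ x, 0 ≤ d x) ∧
    (∑ x, ((p x).toReal : EReal) * dInf (eveChannel W x) (eveLaw p W)) =
      ((∑ x, (p x).toReal * d x : ℝ) : EReal) ∧
    ∀ x z, (p x).toReal ≠ 0 → (eveChannel W x z).toReal ≤
      Real.exp (d x * Real.log 2) * (eveLaw p W z).toReal := by
  have hex : ∀ x, ∃ d : ℝ, 0 ≤ d ∧ ((p x).toReal ≠ 0 →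
      dInf (eveChannel W x) (eveLaw p W) = d ∧ ∀ z, (eveChannel W x z).toReal ≤
        Real.exp (d * Real.log 2) * (eveLaw p W z).toReal) := by
    intro x
    by_cases hx : (p x).toReal = 0
    · exact ⟨0, le_rfl, fun h => absurd hx h⟩
    have hx0 : p x ≠ 0 := fun h => hx (by simp [h])
    -- Since p(x) p(z|x) ≤ p(z), the ratio p(z|x)/p(z) is at most 1/p(x).
    obtain ⟨d, h0, h1, h2⟩ := exists_dInf_eq_coe (p := eveChannel W x) (q := eveLaw p W)
      (ENNReal.inv_ne_top.2 hx0) fun z => by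
        calc eveChannel W x z = (p x)⁻¹ * (p x * eveChannel W x z) := by
              rw [← mul_assoc, ENNReal.inv_mul_cancel hx0 (p.apply_ne_top x), one_mul]
          _ ≤ (p x)⁻¹ * eveLaw p W z := by
              gcongr
              rw [eveLaw, PMF.bind_apply]
              exact ENNReal.le_tsum x
    exact ⟨d, h0, fun _ => ⟨h1, h2⟩⟩
  choose d h0 h1 using hex
  refine ⟨d, h0, ?_, fun x z hx => (h1 x hx).2 z⟩
  have hcoe := map_sum (⟨⟨Real.toEReal, EReal.coe_zero⟩, EReal.coe_add⟩ : ℝ →+ EReal)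
    (fun x => (p x).toReal * d x) Finset.univ
  refine Eq.trans ?_ hcoe.symm
  refine Finset.sum_congr rfl fun x _ => ?_
  by_cases hx : (p x).toReal = 0
  · simp [hx]
  · rw [(h1 x hx).1]
    exact (EReal.coe_mul _ _).symm

section

variable {X Y Z : Type*} [Fintype X] [Fintype Y] [Fintype Z] (p : PMF X) (W : X → PMF (Y × Z))

/-- The factor p(x) cancels inside the logarithm, and log 2 converts bits to nats. -/
theorem mutualInfo_inputOutputLaw_mul_log : mutualInfo (inputOutputLaw p W) * Real.log 2 =
    ∑ x, ∑ y, (p x).toReal * ((W x).map Prod.fst y).toReal *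
      Real.log (((W x).map Prod.fst y).toReal /
        ∑ x, (p x).toReal * ((W x).map Prod.fst y).toReal) := by
  have h2 : Real.log 2 ≠ 0 := (Real.log_pos one_lt_two).ne'
  have hr : inputOutputLaw p W = p.bind fun x => ((W x).map Prod.fst).map fun y => (x, y) := by
    simp only [inputOutputLaw, PMF.map_comp, Function.comp_def]
  have hxy : ∀ x y, inputOutputLaw p W (x, y) = p x * (W x).map Prod.fst y := fun x y => by
    rw [hr, bind_map_pair_apply]
  have hfst : (inputOutputLaw p W).map Prod.fst = p := by
    have hc : ∀ x, (W x).map (fun _ => x) = PMF.pure x := fun x => PMF.map_const (W x) x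
    simp [inputOutputLaw, PMF.map_bind, PMF.map_comp, Function.comp_def, hc]
  have hsnd : (inputOutputLaw p W).map Prod.snd = p.bind fun x => (W x).map Prod.fst := by
    simp only [inputOutputLaw, PMF.map_bind, PMF.map_comp]
    rfl
  have hsnd' : ∀ y, ((p.bind fun x => (W x).map Prod.fst) y).toReal =
      ∑ x, (p x).toReal * ((W x).map Prod.fst y).toReal := fun y => by
    rw [PMF.bind_apply, tsum_fintype, ENNReal.toReal_sum
      fun x _ => ENNReal.mul_ne_top (p.apply_ne_top x) (PMF.apply_ne_top _ y)]
    simp only [ENNReal.toReal_mul]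
  simp only [mutualInfo, hxy, hfst, hsnd, hsnd', ENNReal.toReal_mul, Finset.sum_mul]
  refine Finset.sum_congr rfl fun x _ => Finset.sum_congr rfl fun y _ => ?_
  by_cases hx : (p x).toReal = 0
  · simp [hx]
  rw [mul_div_mul_left _ _ hx, Real.logb, mul_assoc, div_mul_cancel₀ _ h2]

/-- With a single message, feeding the channel with the memoryless input law leaks nothing. -/
theorem exists_code_of_one_message {n M : ℕ} [NeZero M] (hM : M = 1) :
    ∃ C : Code X Y n M, C.errorProb W = 0 ∧ C.leakLaw W =
      indepPair (PMF.uniformOfFintype (Fin M)) (piPMF fun _ : Fin n => eveLaw p W) := by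
  subst hM
  refine ⟨⟨fun _ => piPMF fun _ => p, fun _ => 0⟩, ?_, ?_⟩
  · rw [Code.errorProb_eq]
    refine Finset.sum_eq_zero fun m _ => ?_
    have : {y : Fin n → Y | (0 : Fin 1) ≠ m} = ∅ := by
      ext y
      simp [Subsingleton.elim m 0]
    simp only [this]
    simp
  · ext ⟨m, z⟩
    rw [Code.leakLaw_apply, indepPair_apply, piPMF_bind]
    simp [eveLaw]

theorem codebookCode_leak_ratio_le {n M L : ℕ} [NeZero M] [NeZero L]
    (c : Fin M × Fin L → Fin n → X) (dec : (Fin n → Y) → Fin M) (s : ℝ) (hs : 0 ≤ s)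
    (h : ∀ m (z : Fin n → Z), ∑ j, ∏ i, (eveChannel W (c (m, j) i) (z i)).toReal ≤
      L * (s * ∏ i, (eveLaw p W (z i)).toReal)) :
    ⨆ a, (codebookCode c dec).leakLaw W a /
      indepPair (PMF.uniformOfFintype (Fin M)) (piPMF fun _ : Fin n => eveLaw p W) a ≤
      ENNReal.ofReal s := by
  refine iSup_le fun ⟨m, z⟩ => ENNReal.div_le_of_le_mul ?_
  rw [codebookCode_leakLaw_apply, indepPair_apply, PMF.uniformOfFintype_apply, Fintype.card_fin,
    mul_left_comm (ENNReal.ofReal s)]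
  refine mul_le_mul' le_rfl ?_
  rw [piPMF_apply, mul_comm, ← div_eq_mul_inv]
  refine ENNReal.div_le_of_le_mul ?_
  have h1 := ENNReal.ofReal_le_ofReal (h m z)
  rw [ENNReal.ofReal_sum_of_nonneg fun j _ => Finset.prod_nonneg fun i _ => ENNReal.toReal_nonneg,
    ENNReal.ofReal_mul (Nat.cast_nonneg L), ENNReal.ofReal_natCast, ENNReal.ofReal_mul hs] at h1
  simp only [ENNReal.ofReal_prod_of_nonneg fun i _ => ENNReal.toReal_nonneg,
    ENNReal.ofReal_toReal (PMF.apply_ne_top _ _)] at h1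
  rwa [mul_comm] at h1

end

end Wiretap

/-! ### The secrecy rate -/

theorem mainTheorem9 {X Y Z : Type*} [Fintype X] [Fintype Y] [Fintype Z]
    (W : X → PMF (Y × Z)) (p : PMF X) (R : ℝ)
    (hR : (R : EReal) < (Wiretap.mutualInfo (Wiretap.inputOutputLaw p W) : EReal) -
      ∑ x, ((p x).toReal : EReal) *
        Wiretap.dInf (Wiretap.eveChannel W x) (Wiretap.eveLaw p W)) :
    ∃ C : ∀ n : ℕ, Wiretap.Code X Y n (Wiretap.numMessages R n),
      Tendsto (fun n => (C n).errorProb W) atTop (𝓝 0) ∧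
      Tendsto (fun n => Wiretap.dInf ((C n).leakLaw W)
          (Wiretap.indepPair (PMF.uniformOfFintype (Fin (Wiretap.numMessages R n)))
            (Wiretap.piPMF fun _ : Fin n => Wiretap.eveLaw p W)))
        atTop (𝓝 0) := by
  open Wiretap in
  -- Negative rates are treated apart: the ceiling keeps one message, so the bound M ≤ 2 exp(nR log
  -- 2) fails for large n.
  rcases lt_or_ge R 0 with hneg | hR0
  · choose C h1 h2 using fun n =>
      exists_code_of_one_message (n := n) p W (numMessages_of_nonpos hneg.le n)
    refine ⟨C, ?_, ?_⟩
    · simp [h1]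
    · simp [h2, dInf_self]
  obtain ⟨d, hd0, hdsum, hdU⟩ := exists_letter_divergence p W
  have hl2 : 0 < Real.log 2 := Real.log_pos one_lt_two
  rw [hdsum, ← EReal.coe_sub, EReal.coe_lt_coe_iff] at hR
  have hR' := mul_lt_mul_of_pos_right hR hl2
  rw [sub_mul, mutualInfo_inputOutputLaw_mul_log, Finset.sum_mul] at hR'
  have : Nonempty X := ⟨p.support_nonempty.choose⟩
  have (n : ℕ) : Nonempty (Code X Y n (numMessages R n)) :=
    ⟨⟨fun _ => PMF.pure fun _ => Classical.arbitrary X, fun _ => 0⟩⟩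
  obtain ⟨C, hC⟩ := exists_seq_tendsto_zero
    -- Error and leakage are added so that one diagonal choice makes both vanish.
    (fun n (C : Code X Y n (numMessages R n)) => C.errorProb W + ((⨆ a, C.leakLaw W a /
      indepPair (PMF.uniformOfFintype (Fin (numMessages R n)))
        (piPMF fun _ : Fin n => eveLaw p W) a) - 1)) (by
    intro ε' hε'
    obtain ⟨ε, hε, hε1, hεε'⟩ : ∃ ε : ℝ, 0 < ε ∧ ε ≤ 1 ∧ ENNReal.ofReal (4 * ε) ≤ ε' := by
      have hm0 : 0 < min 1 (ε' / 4) := lt_min one_pos (ENNReal.div_pos hε'.ne' (by simp))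
      have hmt : min 1 (ε' / 4) ≠ ∞ := ne_top_of_le_ne_top ENNReal.one_ne_top (min_le_left _ _)
      refine ⟨(min 1 (ε' / 4)).toReal, ENNReal.toReal_pos hm0.ne' hmt, ?_, ?_⟩
      · simpa using ENNReal.toReal_mono ENNReal.one_ne_top (min_le_left 1 (ε' / 4))
      · rw [ENNReal.ofReal_mul (by norm_num), ENNReal.ofReal_toReal hmt]
        refine (mul_le_mul_of_nonneg_left (min_le_right _ _) zero_le).trans ?_
        rw [ENNReal.ofReal_ofNat]
        exact ENNReal.mul_div_le
    filter_upwards [eventually_exists_codebook (fun x => (p x).toReal)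
      (fun x => d x * Real.log 2) (fun x y => ((W x).map Prod.fst y).toReal)
      (fun x z => (eveChannel W x z).toReal) _ (fun z => (eveLaw p W z).toReal)
      (fun x => ENNReal.toReal_nonneg) (sum_toReal_eq_one p) (fun x y => ENNReal.toReal_nonneg)
      (fun x => sum_toReal_eq_one _) (fun y => rfl) (fun x z => ENNReal.toReal_nonneg)
      (eveLaw_toReal p W) (fun x => mul_nonneg (hd0 x) hl2.le) hdU
      (R := R * Real.log 2) (by
        simp only [mul_assoc] at hR' ⊢
        linarith) (numMessages R) (fun n => NeZero.pos _) (numMessages_le hR0)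
      (ε := ε / 4) (by positivity) (by linarith)] with n ⟨L, hL, c, dec, h1, h2⟩
    have : NeZero L := ⟨hL.ne'⟩
    refine ⟨codebookCode c dec, le_trans ?_ hεε'⟩
    have hM : (0 : ℝ) < numMessages R n := by exact_mod_cast NeZero.pos (numMessages R n)
    have hL' : (0 : ℝ) < L := by exact_mod_cast hL
    have he : (codebookCode c dec).errorProb W ≤ ENNReal.ofReal (ε / 4) := by
      rw [codebookCode_errorProb]
      refine ENNReal.ofReal_le_ofReal ((div_le_iff₀ (by positivity)).2 ?_)
      linarith
    have hl := codebookCode_leak_ratio_le p W c dec _ (by positivity) h2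
    calc _ ≤ ENNReal.ofReal (ε / 4) + (ENNReal.ofReal ((1 + ε / 4) ^ 2) - 1) := by gcongr
      _ ≤ ENNReal.ofReal (4 * ε) := by
        rw [← ENNReal.ofReal_one, ← ENNReal.ofReal_sub _ zero_le_one,
          ← ENNReal.ofReal_add (by positivity) (by nlinarith)]
        exact ENNReal.ofReal_le_ofReal (by nlinarith))
  refine ⟨C, ?_, tendsto_dInf_zero ?_⟩
  · exact tendsto_of_tendsto_of_tendsto_of_le_of_le tendsto_const_nhds hC (fun n => zero_le)
      fun n => le_self_add
  · have h1 := (tendsto_of_tendsto_of_tendsto_of_le_of_le tendsto_const_nhds hC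
      (fun n => zero_le) fun n => le_add_self).add_const 1
    rw [zero_add] at h1
    -- The truncated subtraction loses nothing because the supremum is at least 1.
    exact h1.congr fun n => tsub_add_cancel_of_le (one_le_iSup_div _ _)
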